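/- Let $\mathcal{H}$ be a complex Hilbert space and let $\mathcal{R}\subseteq\mathcal{L}(\mathcal{H})$ be a von Neumann algebra containing the identity operator $I$. Let $\mathcal{P}(\mathcal{R})$ be the complete lattice of orthogonal projections in $\mathcal{R}$, ordered by $P\le Q$ iff $P\mathcal{H}\subseteq Q\mathcal{H}$. A dual ideal of $\mathcal{P}(\mathcal{R})$ is a nonempty subset $\mathcal{J}\subseteq\mathcal{P}(\mathcal{R})$ with $0\notin\mathcal{J}$ such that $P,Q\in\mathcal{J}$ implies $P\wedge Q\in\mathcal{J}$, and $P\in\mathcal{J}$, $P\le Q$ imply $Q\in\mathcal{J}$. The Stone spectrum $\mathcal{Q}(\mathcal{R})$ is the set of all maximal dual ideals of $\mathcal{P}(\mathcal{R})$, with the topology that has the sets $\mathcal{Q}_P(\mathcal{R})=\{\mathfrak{B}\in\mathcal{Q}(\mathcal{R})\mid P\in\mathfrak{B}\}$, $P\in\mathcal{P}(\mathcal{R})$, as a basis. For a selfadjoint $A\in\mathcal{R}$ let $E^A=(E^A_\lambda)_{\lambda\in\mathbb{R}}$ be its spectral family, i.e. the bounded, increasing, right-continuous ($E^A_\lambda=\bigwedge_{\mu>\lambda}E^A_\mu$)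 family in $\mathcal{P}(\mathcal{R})$ with $A=\int_{\mathbb{R}}\lambda\,dE^A_\lambda$ (norm convergence of Riemann–Stieltjes sums); bounded means that $E^A_\lambda=0$ for some $\lambda$ and $E^A_\lambda=I$ for some $\lambda$. The observable function of $A$ is $$f_A:\mathcal{Q}(\mathcal{R})\to\mathbb{R},\qquad f_A(\mathfrak{B})=\inf\{\lambda\in\mathbb{R}\mid E^A_\lambda\in\mathfrak{B}\}.$$ Let $\mathcal{O}(\mathcal{R})=\{f_A\mid A\in\mathcal{R},\ A=A^*\}$, and let $C_b(\mathcal{Q}(\mathcal{R}),\mathbb{R})$ be the set of all bounded continuous functions $\mathcal{Q}(\mathcal{R})\to\mathbb{R}$. **Theorem.** $\mathcal{O}(\mathcal{R})=C_b(\mathcal{Q}(\mathcal{R}),\mathbb{R})$ if and only if $\mathcal{R}$ is abelian. -/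

import Mathlib

namespace StoneObs

section Lattice

variable {L : Type*} [CompleteLattice L]

/-- Dual ideals of a complete lattice: nonempty, proper, meet-closed upper sets. -/
structure IsDualIdeal (J : Set L) : Prop where
  nonempty : J.Nonempty
  bot_notMem : ⊥ ∉ J
  inf_mem : ∀ a ∈ J, ∀ b ∈ J, a ⊓ b ∈ J
  mem_of_le : ∀ a ∈ J, ∀ b, a ≤ b → b ∈ J

variable (L) in
/-- The Stone spectrum of `L`: the set of quasipoints, i.e. of maximal dual ideals. -/
def StoneSpectrum : Type _ := {B : Set L // Maximal IsDualIdeal B}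

/-- The set of quasipoints that contain `a`. -/
def quasipointsAt (a : L) : Set (StoneSpectrum L) := {B | a ∈ B.1}

/-- The topology with the sets `quasipointsAt a` as a basis. -/
instance : TopologicalSpace (StoneSpectrum L) :=
  TopologicalSpace.generateFrom (Set.range quasipointsAt)

/-- Bounded (right-continuous) spectral families in `L`. -/
structure IsBoundedSpectralFamily (E : ℝ → L) : Prop where
  mono : Monotone E
  right_cont : ∀ l : ℝ, E l = ⨅ m ∈ Set.Ioi l, E m
  eq_bot : ∃ l : ℝ, E l = ⊥
  eq_top : ∃ l : ℝ, E l = ⊤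

/-- The function `B ↦ inf {l | E l ∈ B}` on the Stone spectrum. For a bounded spectral family the
set under the infimum is nonempty and bounded below. -/
noncomputable def obsFun (E : ℝ → L) (B : StoneSpectrum L) : ℝ :=
  sInf {l : ℝ | E l ∈ B.1}

/-- The sets `quasipointsAt a` really form a basis of the topology. -/
theorem isTopologicalBasis_quasipointsAt :
    TopologicalSpace.IsTopologicalBasis (Set.range (quasipointsAt (L := L))) where
  exists_subset_inter := by
    rintro _ ⟨a, rfl⟩ _ ⟨b, rfl⟩ B ⟨ha, hb⟩
    refine ⟨_, ⟨a ⊓ b, rfl⟩, B.2.prop.inf_mem a ha b hb, fun C hC => ?_⟩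
    exact ⟨C.2.prop.mem_of_le _ hC _ inf_le_left, C.2.prop.mem_of_le _ hC _ inf_le_right⟩
  sUnion_eq := by
    refine Set.eq_univ_of_forall fun B => ?_
    obtain ⟨a, ha⟩ := B.2.prop.nonempty
    exact ⟨_, ⟨a, rfl⟩, ha⟩
  eq_generateFrom := rfl

end Lattice

section VonNeumann

variable {H : Type*} [NormedAddCommGroup H] [InnerProductSpace ℂ H] [CompleteSpace H]

/-- The orthogonal projections that belong to the von Neumann algebra `R`. -/
structure Proj (R : VonNeumannAlgebra H) where
  op : H →L[ℂ] H
  mem : op ∈ R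
  isStarProjection : IsStarProjection op

variable {R : VonNeumannAlgebra H}

theorem Proj.range_injective :
    Function.Injective (fun p : Proj R => (p.op.range : Submodule ℂ H)) := by
  rintro ⟨p, hp, hp'⟩ ⟨q, hq, hq'⟩ h
  obtain rfl : p = q := ContinuousLinearMap.IsStarProjection.ext hp' hq' h
  rfl

/-- `p ≤ q` means that the range of `p` is contained in the range of `q`. -/
instance : PartialOrder (Proj R) :=
  PartialOrder.lift (fun p : Proj R => (p.op.range : Submodule ℂ H)) Proj.range_injective

theorem Proj.le_def (p q : Proj R) : p ≤ q ↔ p.op.range ≤ q.op.range := Iff.rfl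

theorem Proj.isClosed_range (p : Proj R) : IsClosed (p.op.range : Set H) :=
  ContinuousLinearMap.IsIdempotentElem.isClosed_range p.isStarProjection.isIdempotentElem

/-- The intersection of the ranges of the projections in `S`. -/
def Proj.infRange (S : Set (Proj R)) : Submodule ℂ H := ⨅ p ∈ S, p.op.range

theorem Proj.isClosed_infRange (S : Set (Proj R)) : IsClosed (Proj.infRange S : Set H) := by
  simp only [Proj.infRange, Submodule.coe_iInf]
  exact isClosed_iInter fun p => isClosed_iInter fun _ => p.isClosed_range

instance (S : Set (Proj R)) : CompleteSpace (Proj.infRange S) :=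
  (Proj.isClosed_infRange S).completeSpace_coe

/-- The meet of a set of projections: the projection onto the intersection of the ranges. -/
noncomputable instance : InfSet (Proj R) where
  sInf S :=
    { op := (Proj.infRange S).starProjection
      isStarProjection := isStarProjection_starProjection
      mem := by
        rw [VonNeumannAlgebra.IsStarProjection.mem_iff isStarProjection_starProjection]
        intro y hy
        rw [Submodule.range_starProjection, Module.End.mem_invtSubmodule]
        intro x hx
        simp only [Proj.infRange, Submodule.mem_iInf, Submodule.mem_comap] at hx ⊢
        intro p hp
        exact (VonNeumannAlgebra.IsStarProjection.mem_iff p.isStarProjection R).1 p.mem y hy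
          (hx p hp) }

theorem Proj.range_sInf (S : Set (Proj R)) : (sInf S).op.range = ⨅ p ∈ S, p.op.range :=
  Submodule.range_starProjection _

/-- The projections of a von Neumann algebra form a complete lattice. -/
noncomputable instance : CompleteLattice (Proj R) where
  __ := completeLatticeOfInf (Proj R) fun S => by
    refine ⟨fun p hp => ?_, fun q hq => ?_⟩
    · rw [Proj.le_def, Proj.range_sInf]
      exact iInf₂_le p hp
    · rw [Proj.le_def, Proj.range_sInf]
      exact le_iInf₂ fun p hp => hq hp
  bot := ⟨0, zero_mem R, .zero _⟩
  bot_le p := by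
    rintro _ ⟨x, rfl⟩
    exact zero_mem _
  top := ⟨1, one_mem R, .one _⟩
  le_top p := fun x _ => ⟨x, rfl⟩

/-- `A = ∫ l dE l`, the norm limit of the Riemann-Stieltjes sums over all (tagged) partitions
`t 0 ≤ ⋯ ≤ t n` with `E (t 0) = 0` and `E (t n) = 1`, as the mesh tends to `0`. -/
def IsSpectralIntegral (A : H →L[ℂ] H) (E : ℝ → Proj R) : Prop :=
  ∀ ε > 0, ∃ δ > 0, ∀ (n : ℕ) (t s : ℕ → ℝ), E (t 0) = ⊥ → E (t n) = ⊤ →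
    (∀ k < n, t k ≤ t (k + 1) ∧ t (k + 1) - t k < δ ∧ s k ∈ Set.Icc (t k) (t (k + 1))) →
    ‖A - ∑ k ∈ Finset.range n, (s k : ℂ) • ((E (t (k + 1))).op - (E (t k)).op)‖ < ε

/-- `E` is the spectral family of the selfadjoint operator `A`. -/
structure IsSpectralFamilyOf (A : H →L[ℂ] H) (E : ℝ → Proj R) : Prop where
  isBoundedSpectralFamily : IsBoundedSpectralFamily E
  isSpectralIntegral : IsSpectralIntegral A E

variable (R) in
/-- The set of observable functions `f_A`, where `A` runs through the selfadjoint elements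
of `R`, on the Stone spectrum of the projection lattice of `R`. -/
def observableFunctions : Set (StoneSpectrum (Proj R) → ℝ) :=
  {f | ∃ A ∈ R, IsSelfAdjoint A ∧ ∃ E : ℝ → Proj R, IsSpectralFamilyOf A E ∧ f = obsFun E}

end VonNeumann

end StoneObs

namespace StoneObs

/-! ### Quasipoints and observable functions in a complete lattice. -/

section Lattice

variable {L : Type*} [CompleteLattice L]

/-! Observable functions are always bounded and continuous, because the sets `quasipointsAt a` are
clopen; the question is which continuous functions are observable. If `R` is abelian and `f` is
bounded and continuous, let `E l` be the supremum of the projections `p` with `f ≤ l` on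
`quasipointsAt p`. Disjointness passes to suprema (`Proj.inf_sSup_eq_bot`), so `E l ∈ B` forces `f B
≤ l`, and `obsFun E = f`. Cauchy Riemann-Stieltjes sums turn `E` into an operator of `R`.
Conversely, suppose the indicator of `quasipointsAt p` comes from `E`. Then `E (1 / 2)` lies in
exactly the quasipoints that omit `p`, so it equals `1 - p`, and every quasipoint contains `p` or `1
- p`. This splits each `q` as `q ⊓ p` plus `q ⊓ p.compl`, so `q` commutes with `p`. Dyadic
approximation by projections extends commutation to all of `R`. -/

theorem exists_quasipoint_mem {a : L} (ha : a ≠ ⊥) : ∃ B : StoneSpectrum L, a ∈ B.1 := by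
  have h0 : IsDualIdeal (Set.Ici a) :=
    { nonempty := ⟨a, le_rfl⟩
      bot_notMem := fun h => ha (le_bot_iff.1 h)
      inf_mem := fun b hb c hc => le_inf hb hc
      mem_of_le := fun b hb c hc => le_trans (α := L) hb hc }
  obtain ⟨M, hM, hmax⟩ := zorn_subset_nonempty {J : Set L | IsDualIdeal J}
    (fun c hc hchain hne => by
      refine ⟨⋃₀ c, ?_, fun s hs => Set.subset_sUnion_of_mem hs⟩
      refine ⟨?_, ?_, ?_, ?_⟩
      · obtain ⟨s, hs⟩ := hne
        obtain ⟨x, hx⟩ := (hc hs).nonempty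
        exact ⟨x, s, hs, hx⟩
      · rintro ⟨s, hs, hx⟩
        exact (hc hs).bot_notMem hx
      · rintro x ⟨s, hs, hx⟩ y ⟨t, ht, hy⟩
        rcases hchain.total hs ht with h | h
        · exact ⟨t, ht, (hc ht).inf_mem x (h hx) y hy⟩
        · exact ⟨s, hs, (hc hs).inf_mem x hx y (h hy)⟩
      · rintro x ⟨s, hs, hx⟩ y hxy
        exact ⟨s, hs, (hc hs).mem_of_le x hx y hxy⟩) (Set.Ici a) h0
  exact ⟨⟨M, hmax⟩, hM le_rfl⟩

variable (B : StoneSpectrum L)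

theorem StoneSpectrum.inf_ne_bot {a b : L} (ha : a ∈ B.1) (hb : b ∈ B.1) : a ⊓ b ≠ ⊥ :=
  fun h => B.2.prop.bot_notMem (h ▸ B.2.prop.inf_mem a ha b hb)

theorem StoneSpectrum.top_mem : (⊤ : L) ∈ B.1 := by
  obtain ⟨a, ha⟩ := B.2.prop.nonempty
  exact B.2.prop.mem_of_le a ha _ le_top

/-- Otherwise `B` and `a` would generate a dual ideal, which by maximality is no larger than `B`. -/
theorem StoneSpectrum.exists_inf_eq_bot {a : L} (ha : a ∉ B.1) : ∃ b ∈ B.1, b ⊓ a = ⊥ := by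
  by_contra! h
  have hJ : IsDualIdeal {c : L | ∃ b ∈ B.1, b ⊓ a ≤ c} :=
    { nonempty := ⟨⊤, ⊤, B.top_mem, le_top⟩
      bot_notMem := by
        rintro ⟨b, hb, hle⟩
        exact h b hb (le_bot_iff.1 hle)
      inf_mem := by
        rintro c ⟨b, hb, hc⟩ c' ⟨b', hb', hc'⟩
        refine ⟨b ⊓ b', B.2.prop.inf_mem b hb b' hb', le_inf ?_ ?_⟩
        · exact (inf_le_inf_right _ inf_le_left).trans hc
        · exact (inf_le_inf_right _ inf_le_right).trans hc'
      mem_of_le := by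
        rintro c ⟨b, hb, hc⟩ d hd
        exact ⟨b, hb, hc.trans hd⟩ }
  exact ha (B.2.le_of_ge hJ (fun b hb => ⟨b, hb, inf_le_left⟩) ⟨⊤, B.top_mem, inf_le_right⟩)

theorem isOpen_quasipointsAt (a : L) : IsOpen (quasipointsAt a) :=
  isTopologicalBasis_quasipointsAt.isOpen ⟨a, rfl⟩

theorem isClopen_quasipointsAt (a : L) : IsClopen (quasipointsAt a) := by
  refine ⟨⟨isOpen_iff_forall_mem_open.2 fun B hB => ?_⟩, isOpen_quasipointsAt a⟩
  obtain ⟨b, hb, hba⟩ := B.exists_inf_eq_bot hB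
  exact ⟨quasipointsAt b, fun C hC hCa => C.inf_ne_bot hC hCa hba, isOpen_quasipointsAt b, hb⟩

namespace IsBoundedSpectralFamily

variable {E : ℝ → L} (hE : IsBoundedSpectralFamily E)
include hE

theorem exists_lt_of_mem : ∃ m : ℝ, ∀ (B : StoneSpectrum L) (l : ℝ), E l ∈ B.1 → m < l := by
  obtain ⟨m, hm⟩ := hE.eq_bot
  refine ⟨m, fun B l hl => lt_of_not_ge fun h => B.2.prop.bot_notMem ?_⟩
  exact B.2.prop.mem_of_le _ hl _ (hm ▸ hE.mono h)

theorem obsFun_le {B : StoneSpectrum L} {l : ℝ} (h : E l ∈ B.1) : obsFun E B ≤ l := by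
  obtain ⟨m, hm⟩ := hE.exists_lt_of_mem
  exact csInf_le ⟨m, fun x hx => (hm B x hx).le⟩ h

theorem setOf_mem_nonempty (B : StoneSpectrum L) : {l : ℝ | E l ∈ B.1}.Nonempty := by
  obtain ⟨M, hM⟩ := hE.eq_top
  exact ⟨M, show E M ∈ B.1 from hM ▸ B.top_mem⟩

theorem mem_of_obsFun_lt {B : StoneSpectrum L} {l : ℝ} (h : obsFun E B < l) : E l ∈ B.1 := by
  obtain ⟨x, hx, hxl⟩ := exists_lt_of_csInf_lt (hE.setOf_mem_nonempty B) h
  exact B.2.prop.mem_of_le _ hx _ (hE.mono hxl.le)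

theorem le_obsFun {B : StoneSpectrum L} {l : ℝ} (h : E l ∉ B.1) : l ≤ obsFun E B :=
  le_of_not_gt fun h' => h (hE.mem_of_obsFun_lt h')

theorem continuous_obsFun : Continuous (obsFun E) := by
  rw [continuous_iff_continuousAt]
  intro B
  rw [ContinuousAt, tendsto_order]
  refine ⟨fun l hl => ?_, fun l hl => ?_⟩
  · obtain ⟨m, hlm, hm⟩ := exists_between hl
    have hmB : E m ∉ B.1 := fun h => absurd (hE.obsFun_le h) (not_le.2 hm)
    filter_upwards [(isClopen_quasipointsAt (E m)).compl.isOpen.mem_nhds hmB] with C hC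
    exact hlm.trans_le (hE.le_obsFun hC)
  · obtain ⟨m, hm, hml⟩ := exists_between hl
    filter_upwards [(isOpen_quasipointsAt (E m)).mem_nhds (hE.mem_of_obsFun_lt hm)] with C hC
    exact (hE.obsFun_le hC).trans_lt hml

theorem exists_boundedContinuousFunction :
    ∃ g : BoundedContinuousFunction (StoneSpectrum L) ℝ, (fun B => g B) = obsFun E := by
  obtain ⟨m, hm⟩ := hE.exists_lt_of_mem
  obtain ⟨M, hM⟩ := hE.eq_top
  refine ⟨BoundedContinuousFunction.ofNormedAddCommGroup (obsFun E) hE.continuous_obsFun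
    (max |m| |M|) fun B => ?_, rfl⟩
  refine abs_le_max_abs_abs (le_csInf (hE.setOf_mem_nonempty B) fun l hl => (hm B l hl).le) ?_
  exact hE.obsFun_le (hM ▸ B.top_mem)

end IsBoundedSpectralFamily

end Lattice

/-! ### Operator estimates and the orthomodular lattice of projections. -/

section VonNeumann

open ContinuousLinearMap

variable {H : Type*} [NormedAddCommGroup H] [InnerProductSpace ℂ H] [CompleteSpace H]

/-- The bounds make `y` selfadjoint, so `‖y‖` or `-‖y‖` lies in its spectrum. -/
theorem norm_le_of_neg_le_of_le {y : H →L[ℂ] H} {c : ℝ} (hc : 0 ≤ c)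
    (h₁ : -algebraMap ℝ (H →L[ℂ] H) c ≤ y) (h₂ : y ≤ algebraMap ℝ (H →L[ℂ] H) c) : ‖y‖ ≤ c := by
  cases subsingleton_or_nontrivial (H →L[ℂ] H) with
  | inl h => rw [Subsingleton.elim y 0, norm_zero]; exact hc
  | inr h =>
    have hy : IsSelfAdjoint y := by
      have h3 := (IsSelfAdjoint.algebraMap (H →L[ℂ] H) (IsSelfAdjoint.all c)).sub
        (IsSelfAdjoint.of_nonneg (sub_nonneg.2 h₂))
      simpa using h3
    rw [← map_neg] at h₁
    rw [le_algebraMap_iff_spectrum_le] at h₂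
    rw [algebraMap_le_iff_le_spectrum] at h₁
    rcases CStarAlgebra.norm_or_neg_norm_mem_spectrum hy with h | h
    · exact h₂ _ h
    · linarith [h₁ _ h]

/-- The norm of a combination of positive operators with sum `1` is at most the largest
coefficient. -/
theorem norm_sum_smul_le {ι : Type*} (s : Finset ι) (Q : ι → H →L[ℂ] H) (c : ι → ℝ) {d : ℝ}
    (hd : 0 ≤ d) (hQ : ∀ i ∈ s, 0 ≤ Q i) (hsum : ∑ i ∈ s, Q i = 1)
    (hc : ∀ i ∈ s, Q i ≠ 0 → |c i| ≤ d) : ‖∑ i ∈ s, c i • Q i‖ ≤ d := by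
  have h1 : algebraMap ℝ (H →L[ℂ] H) d = ∑ i ∈ s, d • Q i := by
    rw [← Finset.smul_sum, hsum, Algebra.algebraMap_eq_smul_one]
  refine norm_le_of_neg_le_of_le hd ?_ ?_
  · rw [h1, ← Finset.sum_neg_distrib]
    refine Finset.sum_le_sum fun i hi => ?_
    by_cases h0 : Q i = 0
    · simp [h0]
    · rw [← neg_smul]
      exact smul_le_smul_of_nonneg_right (abs_le.1 (hc i hi h0)).1 (hQ i hi)
  · rw [h1]
    refine Finset.sum_le_sum fun i hi => ?_
    by_cases h0 : Q i = 0
    · simp [h0]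
    · exact smul_le_smul_of_nonneg_right (abs_le.1 (hc i hi h0)).2 (hQ i hi)

variable {R : VonNeumannAlgebra H}

theorem isClosed_vonNeumannAlgebra (R : VonNeumannAlgebra H) :
    IsClosed (R : Set (H →L[ℂ] H)) := by
  rw [← R.centralizer_centralizer]
  exact Set.isClosed_centralizer _

theorem smul_mem_vonNeumannAlgebra (c : ℂ) {a : H →L[ℂ] H} (ha : a ∈ R) : c • a ∈ R :=
  R.toStarSubalgebra.smul_mem ha c

theorem Proj.mem_range_iff (p : Proj R) {x : H} : x ∈ p.op.range ↔ p.op x = x := by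
  refine ⟨?_, fun h => ⟨x, h⟩⟩
  rintro ⟨y, rfl⟩
  exact congr($(p.isStarProjection.isIdempotentElem) y)

theorem Proj.mul_self (p : Proj R) : p.op * p.op = p.op := p.isStarProjection.isIdempotentElem

theorem Proj.le_iff_mul_eq (p q : Proj R) : p ≤ q ↔ q.op * p.op = p.op := by
  refine ⟨fun h => ?_, fun h => ?_⟩
  · ext x
    exact q.mem_range_iff.1 (h ⟨x, rfl⟩)
  · rintro _ ⟨x, rfl⟩
    exact q.mem_range_iff.2 congr($h x)

theorem Proj.le_iff_mul_eq' (p q : Proj R) : p ≤ q ↔ p.op * q.op = p.op := by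
  rw [p.le_iff_mul_eq, ← star_inj, star_mul, p.isStarProjection.isSelfAdjoint.star_eq,
    q.isStarProjection.isSelfAdjoint.star_eq]

theorem Proj.op_bot : (⊥ : Proj R).op = 0 := rfl

theorem Proj.op_top : (⊤ : Proj R).op = 1 := rfl

theorem Proj.mem_range_inf (p q : Proj R) {x : H} :
    x ∈ (p ⊓ q).op.range ↔ x ∈ p.op.range ∧ x ∈ q.op.range := by
  have h : p ⊓ q = sInf {p, q} := sInf_pair.symm
  rw [h, Proj.range_sInf]
  simp

theorem Proj.eq_bot_iff (p : Proj R) : p = ⊥ ↔ ∀ x ∈ p.op.range, x = 0 := by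
  rw [← le_bot_iff, Proj.le_def]
  refine forall₂_congr fun x _ => ?_
  rw [Proj.mem_range_iff, Proj.op_bot, zero_apply, eq_comm]

/-- The orthogonal complement of a projection. -/
def Proj.compl (p : Proj R) : Proj R :=
  ⟨1 - p.op, sub_mem (one_mem R) p.mem, p.isStarProjection.one_sub⟩

theorem Proj.op_compl (p : Proj R) : p.compl.op = 1 - p.op := rfl

theorem Proj.mem_range_compl (p : Proj R) {x : H} : x ∈ p.compl.op.range ↔ p.op x = 0 := by
  rw [Proj.mem_range_iff, Proj.op_compl]
  simp

theorem Proj.inf_compl (p : Proj R) : p ⊓ p.compl = ⊥ := by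
  rw [Proj.eq_bot_iff]
  intro x hx
  rw [Proj.mem_range_inf, Proj.mem_range_iff, Proj.mem_range_compl] at hx
  exact hx.1.symm.trans hx.2

theorem Proj.le_compl_iff (p q : Proj R) : p ≤ q.compl ↔ q.op * p.op = 0 := by
  rw [Proj.le_iff_mul_eq, Proj.op_compl, sub_mul, one_mul, sub_eq_self]

/-- A form of the orthomodular law. -/
theorem Proj.le_of_inf_compl_inf_eq_bot {p q : Proj R} (h : p ⊓ (p ⊓ q).compl = ⊥) : p ≤ q := by
  intro x hx
  have hM : (p ⊓ q).op x ∈ (p ⊓ q).op.range := ⟨x, rfl⟩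
  have hM' := (Proj.mem_range_inf p q).1 hM
  have h0 : x - (p ⊓ q).op x = 0 := by
    refine (Proj.eq_bot_iff _).1 h _ ((Proj.mem_range_inf _ _).2 ⟨sub_mem hx hM'.1, ?_⟩)
    rw [Proj.mem_range_compl, map_sub, (Proj.mem_range_iff _).1 hM, sub_self]
  rw [sub_eq_zero.1 h0]
  exact hM'.2

end VonNeumann
end StoneObs

namespace StoneObs
-- Convergence of Riemann-Stieltjes sums.
section VonNeumann

open ContinuousLinearMap

variable {H : Type*} [NormedAddCommGroup H] [InnerProductSpace ℂ H] [CompleteSpace H]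
variable {R : VonNeumannAlgebra H}

theorem Proj.isStarProjection_sub {p q : Proj R} (h : p ≤ q) : IsStarProjection (q.op - p.op) where
  isIdempotentElem := by
    have h1 := (p.le_iff_mul_eq q).1 h
    have h2 := (p.le_iff_mul_eq' q).1 h
    rw [IsIdempotentElem, sub_mul, mul_sub, mul_sub, h1, h2, p.mul_self, q.mul_self]
    abel
  isSelfAdjoint := q.isStarProjection.isSelfAdjoint.sub p.isStarProjection.isSelfAdjoint

variable {E : ℝ → Proj R}

theorem op_mul_op_of_le (hE : Monotone E) {l m : ℝ} (h : l ≤ m) : (E l).op * (E m).op = (E l).op :=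
  ((E l).le_iff_mul_eq' _).1 (hE h)

theorem op_mul_op_of_ge (hE : Monotone E) {l m : ℝ} (h : l ≤ m) : (E m).op * (E l).op = (E l).op :=
  ((E l).le_iff_mul_eq _).1 (hE h)

theorem op_commute (hE : Monotone E) (l m : ℝ) : Commute (E l).op (E m).op := by
  rcases le_total l m with h | h
  · exact (op_mul_op_of_le hE h).trans (op_mul_op_of_ge hE h).symm
  · exact (op_mul_op_of_ge hE h).trans (op_mul_op_of_le hE h).symm

/-- The increment of a family of projections over the interval from `l` to `m`. -/
def increment (E : ℝ → Proj R) (l m : ℝ) : H →L[ℂ] H := (E m).op - (E l).op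

theorem increment_mul_nonneg (hE : Monotone E) {l m l' m' : ℝ} (h : l ≤ m) (h' : l' ≤ m') :
    0 ≤ increment E l m * increment E l' m' := by
  have hc : Commute (increment E l m) (increment E l' m') :=
    ((op_commute hE _ _).sub_right (op_commute hE _ _)).sub_left
      ((op_commute hE _ _).sub_right (op_commute hE _ _))
  exact hc.mul_nonneg (Proj.isStarProjection_sub (hE h)).nonneg
    (Proj.isStarProjection_sub (hE h')).nonneg

theorem increment_mul_eq_zero (hE : Monotone E) {l m l' m' : ℝ} (h : l ≤ m) (h' : l' ≤ m')
    (hd : m ≤ l' ∨ m' ≤ l) : increment E l m * increment E l' m' = 0 := by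
  rw [increment, increment, sub_mul, mul_sub, mul_sub]
  rcases hd with hd | hd
  · rw [op_mul_op_of_le hE (hd.trans h'), op_mul_op_of_le hE hd,
      op_mul_op_of_le hE (h.trans (hd.trans h')), op_mul_op_of_le hE (h.trans hd)]
    abel
  · rw [op_mul_op_of_ge hE (hd.trans h), op_mul_op_of_ge hE (h'.trans (hd.trans h)),
      op_mul_op_of_ge hE hd, op_mul_op_of_ge hE (h'.trans hd)]
    abel

/-- The sequences `t`, `s` describe a tagged partition of mesh at most `d` covering the support
of `E`. -/
structure IsTaggedPartition (E : ℝ → Proj R) (n : ℕ) (t s : ℕ → ℝ) (d : ℝ) : Prop where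
  eq_bot : E (t 0) = ⊥
  eq_top : E (t n) = ⊤
  le_succ : ∀ k < n, t k ≤ t (k + 1)
  sub_le : ∀ k < n, t (k + 1) - t k ≤ d
  mem_Icc : ∀ k < n, s k ∈ Set.Icc (t k) (t (k + 1))

/-- The Riemann-Stieltjes sum of a tagged partition. -/
noncomputable def stieltjesSum (E : ℝ → Proj R) (n : ℕ) (t s : ℕ → ℝ) : H →L[ℂ] H :=
  ∑ k ∈ Finset.range n, (s k : ℂ) • ((E (t (k + 1))).op - (E (t k)).op)

theorem stieltjesSum_eq (E : ℝ → Proj R) (n : ℕ) (t s : ℕ → ℝ) :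
    stieltjesSum E n t s = ∑ k ∈ Finset.range n, s k • increment E (t k) (t (k + 1)) :=
  Finset.sum_congr rfl fun _ _ => Complex.coe_smul _ _

theorem IsTaggedPartition.sum_increment {n : ℕ} {t s : ℕ → ℝ} {d : ℝ}
    (h : IsTaggedPartition E n t s d) :
    ∑ k ∈ Finset.range n, increment E (t k) (t (k + 1)) = 1 := by
  have := Finset.sum_range_sub (fun k => (E (t k)).op) n
  rw [h.eq_bot, h.eq_top, Proj.op_bot, Proj.op_top, sub_zero] at this
  exact this

/-- Both sums expand over the products `D k * D' j`, positive operators with sum `1`. A product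
vanishes unless its two intervals overlap, and then the tags differ by at most `d + d'`. No common
refinement is needed. -/
theorem norm_stieltjesSum_sub_le (hE : Monotone E) {n n' : ℕ} {t s t' s' : ℕ → ℝ} {d d' : ℝ}
    (hd : 0 ≤ d) (hd' : 0 ≤ d')
    (h : IsTaggedPartition E n t s d) (h' : IsTaggedPartition E n' t' s' d') :
    ‖stieltjesSum E n t s - stieltjesSum E n' t' s'‖ ≤ d + d' := by
  set D := fun k => increment E (t k) (t (k + 1))
  set D' := fun k => increment E (t' k) (t' (k + 1))
  have h1 : stieltjesSum E n t s = ∑ i ∈ Finset.range n ×ˢ Finset.range n',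
      s i.1 • (D i.1 * D' i.2) := by
    rw [Finset.sum_product, stieltjesSum_eq]
    refine Finset.sum_congr rfl fun k _ => ?_
    dsimp only
    rw [← Finset.smul_sum, ← Finset.mul_sum, h'.sum_increment, mul_one]
  have h2 : stieltjesSum E n' t' s' = ∑ i ∈ Finset.range n ×ˢ Finset.range n',
      s' i.2 • (D i.1 * D' i.2) := by
    rw [Finset.sum_product_right, stieltjesSum_eq]
    refine Finset.sum_congr rfl fun k _ => ?_
    dsimp only
    rw [← Finset.smul_sum, ← Finset.sum_mul, h.sum_increment, one_mul]
  rw [h1, h2, ← Finset.sum_sub_distrib]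
  simp_rw [← sub_smul]
  refine norm_sum_smul_le _ (fun i : ℕ × ℕ => D i.1 * D' i.2) (fun i => s i.1 - s' i.2)
    (add_nonneg hd hd') ?_ ?_ ?_
  · rintro ⟨k, j⟩ hi
    rw [Finset.mem_product, Finset.mem_range, Finset.mem_range] at hi
    exact increment_mul_nonneg hE (h.le_succ k hi.1) (h'.le_succ j hi.2)
  · rw [Finset.sum_product]
    simp_rw [← Finset.mul_sum]
    rw [h'.sum_increment]
    simp_rw [mul_one]
    exact h.sum_increment
  · rintro ⟨k, j⟩ hi h0
    rw [Finset.mem_product, Finset.mem_range, Finset.mem_range] at hi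
    obtain ⟨hk, hj⟩ := hi
    dsimp only at hk hj h0 ⊢
    have h3 : ¬ (t (k + 1) ≤ t' j ∨ t' (j + 1) ≤ t k) := fun hd =>
      h0 (increment_mul_eq_zero hE (h.le_succ k hk) (h'.le_succ j hj) hd)
    push Not at h3
    have h4 := h.mem_Icc k hk
    have h5 := h'.mem_Icc j hj
    have h6 := h.sub_le k hk
    have h7 := h'.sub_le j hj
    rw [abs_le]
    constructor <;> linarith [h4.1, h4.2, h5.1, h5.2, h3.1, h3.2]

theorem IsBoundedSpectralFamily.exists_isTaggedPartition (hE : IsBoundedSpectralFamily E) {d : ℝ}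
    (hd : 0 < d) : ∃ n t s, IsTaggedPartition E n t s d := by
  obtain ⟨a, ha⟩ := hE.eq_bot
  obtain ⟨b, hb⟩ := hE.eq_top
  obtain ⟨n, hn⟩ := Archimedean.arch (b - a) hd
  rw [nsmul_eq_mul] at hn
  refine ⟨n, fun k => a + k * d, fun k => a + k * d, ?_, ?_, ?_, ?_, ?_⟩
  · simpa using ha
  · rw [eq_top_iff, ← hb]
    exact hE.mono (by linarith)
  all_goals
    intro k _
    push_cast
  · linarith
  · linarith
  · exact ⟨le_rfl, by linarith⟩

theorem isSelfAdjoint_stieltjesSum (E : ℝ → Proj R) (n : ℕ) (t s : ℕ → ℝ) :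
    IsSelfAdjoint (stieltjesSum E n t s) := by
  rw [stieltjesSum_eq]
  refine isSelfAdjoint_sum _ fun k _ => ?_
  exact (IsSelfAdjoint.all (s k)).smul
    ((E _).isStarProjection.isSelfAdjoint.sub (E _).isStarProjection.isSelfAdjoint)

theorem stieltjesSum_mem (E : ℝ → Proj R) (n : ℕ) (t s : ℕ → ℝ) : stieltjesSum E n t s ∈ R :=
  sum_mem fun _ _ => smul_mem_vonNeumannAlgebra _ (sub_mem (E _).mem (E _).mem)

/-- Every bounded spectral family is the spectral family of a selfadjoint operator in `R`. -/
theorem IsBoundedSpectralFamily.exists_isSpectralFamilyOf (hE : IsBoundedSpectralFamily E) :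
    ∃ A ∈ R, IsSelfAdjoint A ∧ IsSpectralFamilyOf A E := by
  have hpos : ∀ m : ℕ, (0 : ℝ) < 1 / (m + 1) := fun m => Nat.one_div_pos_of_nat
  choose n t s h using fun m : ℕ => hE.exists_isTaggedPartition (hpos m)
  set S : ℕ → H →L[ℂ] H := fun m => stieltjesSum E (n m) (t m) (s m) with hS
  have hC : CauchySeq S := by
    refine cauchySeq_of_le_tendsto_0 (fun N : ℕ => 1 / ((N : ℝ) + 1) + 1 / ((N : ℝ) + 1)) ?_ ?_
    · intro p q N hp hq
      rw [dist_eq_norm]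
      exact (norm_stieltjesSum_sub_le hE.mono (hpos p).le (hpos q).le (h p) (h q)).trans
        (add_le_add (Nat.one_div_le_one_div hp) (Nat.one_div_le_one_div hq))
    · simpa using tendsto_one_div_add_atTop_nhds_zero_nat (𝕜 := ℝ).add
        tendsto_one_div_add_atTop_nhds_zero_nat
  obtain ⟨A, hA⟩ := cauchySeq_tendsto_of_complete hC
  refine ⟨A, (isClosed_vonNeumannAlgebra R).mem_of_tendsto hA
      (Filter.Eventually.of_forall fun m => stieltjesSum_mem _ _ _ _),
    (isClosed_eq continuous_star continuous_id).mem_of_tendsto hA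
      (Filter.Eventually.of_forall fun m => isSelfAdjoint_stieltjesSum _ _ _ _), hE, ?_⟩
  intro ε hε
  -- The bound `1 / (m + 1) + ε / 2` tends to `ε / 2`, which keeps the final inequality strict.
  refine ⟨ε / 2, half_pos hε, fun N τ σ h0 h1 hτ => ?_⟩
  have hP : IsTaggedPartition E N τ σ (ε / 2) :=
    ⟨h0, h1, fun k hk => (hτ k hk).1, fun k hk => (hτ k hk).2.1.le, fun k hk => (hτ k hk).2.2⟩
  have h2 : ‖A - stieltjesSum E N τ σ‖ ≤ 0 + ε / 2 :=
    le_of_tendsto_of_tendsto' (hA.sub_const _).norm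
      ((tendsto_one_div_add_atTop_nhds_zero_nat (𝕜 := ℝ)).add_const _)
      fun m => norm_stieltjesSum_sub_le hE.mono (hpos m).le (half_pos hε).le (h m) hP
  exact lt_of_le_of_lt h2 (by linarith)

end VonNeumann
end StoneObs

namespace StoneObs
-- From clopen indicators to commuting projections.
section VonNeumann

open ContinuousLinearMap

variable {H : Type*} [NormedAddCommGroup H] [InnerProductSpace ℂ H] [CompleteSpace H]
variable {R : VonNeumannAlgebra H}

/-- A quasipoint through a nonzero `p ⊓ (p ⊓ q).compl` would contain `p`, hence `q`, hence `p ⊓ q`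
together with its complement. -/
theorem Proj.le_of_quasipointsAt_subset {p q : Proj R} (h : quasipointsAt p ⊆ quasipointsAt q) :
    p ≤ q := by
  refine Proj.le_of_inf_compl_inf_eq_bot ?_
  by_contra hne
  obtain ⟨B, hB⟩ := exists_quasipoint_mem hne
  have hp : p ∈ B.1 := B.2.prop.mem_of_le _ hB _ inf_le_left
  exact B.inf_ne_bot (B.2.prop.inf_mem p hp q (h hp)) (B.2.prop.mem_of_le _ hB _ inf_le_right)
    (Proj.inf_compl _)

theorem Proj.eq_compl_of_quasipoints {p f : Proj R}
    (h : ∀ B : StoneSpectrum (Proj R), f ∈ B.1 ↔ p ∉ B.1) : f = p.compl := by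
  have hle : p.compl ≤ f := Proj.le_of_quasipointsAt_subset fun B hB =>
    (h B).2 fun hp => B.inf_ne_bot hp hB p.inf_compl
  have hbot : f ⊓ p = ⊥ := by
    by_contra hne
    obtain ⟨B, hB⟩ := exists_quasipoint_mem hne
    exact (h B).1 (B.2.prop.mem_of_le _ hB _ inf_le_left) (B.2.prop.mem_of_le _ hB _ inf_le_right)
  -- Disjointness from `p` alone does not give `f ≤ p.compl`. Here `p.compl ≤ f` puts `x - p x`,
  -- hence `p x`, in the range of `f`, so `p x = 0`.
  refine le_antisymm (fun x hx => ?_) hle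
  rw [Proj.mem_range_compl]
  refine (Proj.eq_bot_iff _).1 hbot _ ((Proj.mem_range_inf _ _).2 ⟨?_, x, rfl⟩)
  have h1 : x - p.op x ∈ f.op.range := hle ⟨x, by simp [Proj.op_compl]⟩
  simpa using sub_mem hx h1

/-- A projection `q` commutes with `p` if every quasipoint contains `p` or its complement. -/
theorem Proj.commute_of_quasipoints {p : Proj R}
    (h : ∀ B : StoneSpectrum (Proj R), p ∈ B.1 ∨ p.compl ∈ B.1) (q : Proj R) :
    Commute q.op p.op := by
  set m := q ⊓ p with hm
  set n := q ⊓ p.compl with hn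
  -- A quasipoint through this meet would contain `p` or `p.compl`, hence `m` or `n`, against its
  -- complement.
  have hbot : q ⊓ (m.compl ⊓ n.compl) = ⊥ := by
    by_contra hne
    obtain ⟨B, hB⟩ := exists_quasipoint_mem hne
    have hq : q ∈ B.1 := B.2.prop.mem_of_le _ hB _ inf_le_left
    rcases h B with hp | hp
    · exact B.inf_ne_bot (B.2.prop.inf_mem q hq p hp)
        (B.2.prop.mem_of_le _ hB _ (inf_le_right.trans inf_le_left)) (Proj.inf_compl _)
    · exact B.inf_ne_bot (B.2.prop.inf_mem q hq _ hp)
        (B.2.prop.mem_of_le _ hB _ (inf_le_right.trans inf_le_right)) (Proj.inf_compl _)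
  have hmq : m ≤ q := inf_le_left
  have hnq : n ≤ q := inf_le_left
  have hmp : m ≤ p := inf_le_right
  have hnp : n ≤ p.compl := inf_le_right
  have hpm := (m.le_iff_mul_eq p).1 hmp
  have hmp' := (m.le_iff_mul_eq' p).1 hmp
  have hpn := (n.le_compl_iff p).1 hnp
  have hnp' : n.op * p.op = 0 := by
    have := (n.le_iff_mul_eq' _).1 hnp
    rwa [Proj.op_compl, mul_sub, mul_one, sub_eq_self] at this
  have hmn : m.op * n.op = 0 := by rw [← hmp', mul_assoc, hpn, mul_zero]
  have hnm : n.op * m.op = 0 := by rw [← hpm, ← mul_assoc, hnp', zero_mul]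
  have hq : q.op = m.op + n.op := by
    have key : q.op - (m.op + n.op) = 0 := by
      have hqq : q.op * (q.op - (m.op + n.op)) = q.op - (m.op + n.op) := by
        rw [mul_sub, mul_add, q.mul_self, (m.le_iff_mul_eq q).1 hmq, (n.le_iff_mul_eq q).1 hnq]
      have hmm : m.op * (q.op - (m.op + n.op)) = 0 := by
        rw [mul_sub, mul_add, (m.le_iff_mul_eq' q).1 hmq, m.mul_self, hmn, add_zero, sub_self]
      have hnn : n.op * (q.op - (m.op + n.op)) = 0 := by
        rw [mul_sub, mul_add, (n.le_iff_mul_eq' q).1 hnq, n.mul_self, hnm, zero_add, sub_self]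
      ext x
      refine (Proj.eq_bot_iff _).1 hbot _ ?_
      rw [Proj.mem_range_inf, Proj.mem_range_inf, Proj.mem_range_iff, Proj.mem_range_compl,
        Proj.mem_range_compl]
      exact ⟨congr($hqq x), congr($hmm x), congr($hnn x)⟩
    exact sub_eq_zero.1 key
  rw [Commute, SemiconjBy, hq, add_mul, mul_add, hmp', hnp', hpm, hpn]

/-- If all continuous functions on the Stone spectrum are observable functions then all projections
commute. -/
theorem Proj.commute_of_continuous_subset
    (h : ∀ g : BoundedContinuousFunction (StoneSpectrum (Proj R)) ℝ,
      (fun B => g B) ∈ observableFunctions R) (p q : Proj R) : Commute q.op p.op := by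
  classical
  refine Proj.commute_of_quasipoints (p := p) ?_ q
  have hg := h (BoundedContinuousFunction.indicator (quasipointsAt p) (isClopen_quasipointsAt p))
  obtain ⟨A, -, -, E, ⟨hE, -⟩, hfE⟩ := hg
  -- Any level strictly between the values `0` and `1` of the indicator would do.
  have hF : E (1 / 2) = p.compl := by
    refine Proj.eq_compl_of_quasipoints fun B => ⟨fun hB hp => ?_, fun hp => ?_⟩
    · have h1 := hE.obsFun_le hB
      have h2 : B ∈ quasipointsAt p := hp
      rw [← congrFun hfE B] at h1
      norm_num [h2] at h1
    · refine hE.mem_of_obsFun_lt ?_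
      have h2 : B ∉ quasipointsAt p := hp
      rw [← congrFun hfE B]
      norm_num [h2]
  intro B
  by_contra! hB
  refine hB.2 (hF ▸ hE.mem_of_obsFun_lt ?_)
  have h2 : B ∉ quasipointsAt p := hB.1
  rw [← congrFun hfE B]
  norm_num [h2]

/-! ### Commutation passes from projections to the whole algebra. -/

/-- One step of the dyadic approximation of a selfadjoint operator by projections of `R`. -/
theorem exists_proj_norm_sub_le {x : H →L[ℂ] H} (hx : x ∈ R) (hsa : IsSelfAdjoint x) {r : ℝ}
    (hr : ‖x‖ ≤ r) : ∃ e : Proj R, ‖x - (r / 2) • ((2 : ℝ) • e.op - 1)‖ ≤ r / 2 := by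
  have hr0 : 0 ≤ r := (norm_nonneg x).trans hr
  have hpos : (0 : H →L[ℂ] H) ≤ x⁺ := CFC.posPart_nonneg x
  have hneg : (0 : H →L[ℂ] H) ≤ x⁻ := CFC.negPart_nonneg x
  -- The projection onto `K` fixes `x⁺` and kills `x⁻`. Subtracting `r / 2` on `K` and `-r / 2` on
  -- its complement leaves `x⁺ - r / 2` and `r / 2 - x⁻`, both of norm at most `r / 2`.
  set K := (x⁺ : H →L[ℂ] H).range.topologicalClosure with hK
  have : CompleteSpace K := Submodule.topologicalClosure.completeSpace _
  have hmem : K.starProjection ∈ R := by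
    rw [VonNeumannAlgebra.IsStarProjection.mem_iff isStarProjection_starProjection]
    intro y hy
    have hc : Commute y x⁺ := by
      have : Commute x y := VonNeumannAlgebra.mem_commutant_iff.1 hy x hx
      exact (IsSelfAdjoint.commute_cfcₙ hsa this _).symm
    rw [Submodule.range_starProjection, Module.End.mem_invtSubmodule]
    refine Submodule.topologicalClosure_minimal _ ?_ ?_
    · rintro _ ⟨z, rfl⟩
      refine Submodule.le_topologicalClosure _ ⟨y z, ?_⟩
      exact congr($hc.symm z)
    · exact (Submodule.isClosed_topologicalClosure _).preimage y.continuous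
  set e : Proj R := ⟨K.starProjection, hmem, isStarProjection_starProjection⟩ with he
  have hstar : star e.op = e.op := e.isStarProjection.isSelfAdjoint.star_eq
  have hep : e.op * x⁺ = x⁺ := by
    ext z
    exact Submodule.starProjection_eq_self_iff.2 (Submodule.le_topologicalClosure _ ⟨z, rfl⟩)
  have hpe : x⁺ * e.op = x⁺ := by
    have := congr(star $hep)
    rwa [star_mul, hstar, (IsSelfAdjoint.of_nonneg hpos).star_eq] at this
  have hne : x⁻ * e.op = 0 := by
    have h1 : K ≤ (x⁻ : H →L[ℂ] H).ker := by
      refine Submodule.topologicalClosure_minimal _ ?_ (isClosed_ker _)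
      rintro _ ⟨z, rfl⟩
      exact congr($(CFC.negPart_mul_posPart x) z)
    ext z
    exact h1 (Submodule.starProjection_apply_mem K z)
  have hen : e.op * x⁻ = 0 := by
    have := congr(star $hne)
    rwa [star_mul, hstar, (IsSelfAdjoint.of_nonneg hneg).star_eq, star_zero] at this
  have bound : ∀ y : H →L[ℂ] H, 0 ≤ y → ‖y‖ ≤ ‖x‖ → ∀ f : H →L[ℂ] H, IsStarProjection f →
      f * y = y → y * f = y → y ≤ r • f := by
    intro y hy hyx f hf h1 h2
    have h3 : y ≤ algebraMap ℝ (H →L[ℂ] H) r :=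
      (CStarAlgebra.norm_le_iff_le_algebraMap y hr0 hy).1 (hyx.trans hr)
    have h4 := star_left_conjugate_le_conjugate h3 f
    rwa [hf.isSelfAdjoint.star_eq, h1, h2, Algebra.algebraMap_eq_smul_one, mul_smul_comm, mul_one,
      smul_mul_assoc, hf.isIdempotentElem] at h4
  have hb1 : x⁺ ≤ r • e.op :=
    bound _ hpos (CStarAlgebra.norm_posPart_le x) _ e.isStarProjection hep hpe
  have hb2 : x⁻ ≤ r • (1 - e.op) := by
    refine bound _ hneg (CStarAlgebra.norm_negPart_le x) _ e.isStarProjection.one_sub ?_ ?_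
    · rw [sub_mul, one_mul, hen, sub_zero]
    · rw [mul_sub, mul_one, hne, sub_zero]
  have hxe : x⁺ - x⁻ = x := CFC.posPart_sub_negPart x hsa
  have hsplit : (r / 2) • ((2 : ℝ) • e.op - 1) = r • e.op - (r / 2) • 1 := by
    rw [smul_sub, smul_smul, div_mul_cancel₀ r two_ne_zero]
  have hr2 : r • (1 : H →L[ℂ] H) = (r / 2) • 1 + (r / 2) • 1 := by
    rw [← add_smul, add_halves]
  refine ⟨e, norm_le_of_neg_le_of_le (by linarith) ?_ ?_⟩
  · rw [hsplit, Algebra.algebraMap_eq_smul_one, ← sub_nonneg]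
    rw [smul_sub, hr2] at hb2
    have : x - (r • e.op - (r / 2) • 1) - -((r / 2) • 1)
        = x⁺ + ((r / 2) • 1 + (r / 2) • 1 - r • e.op - x⁻) := by
      nth_rw 1 [← hxe]; abel
    rw [this]
    exact add_nonneg hpos (sub_nonneg.2 hb2)
  · rw [hsplit, Algebra.algebraMap_eq_smul_one, ← sub_nonneg]
    have : (r / 2) • 1 - (x - (r • e.op - (r / 2) • 1)) = (r • e.op - x⁺) + x⁻ := by
      nth_rw 1 [← hxe]; abel
    rw [this]
    exact add_nonneg (sub_nonneg.2 hb1) hneg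

/-- Each dyadic step subtracts an operator commuting with `b`: the commutator is unchanged while the
norm bound on `x` halves. -/
theorem norm_commutator_le_of_commute_proj {b : H →L[ℂ] H} (hb : ∀ e : Proj R, Commute e.op b)
    (n : ℕ) {r : ℝ} {x : H →L[ℂ] H} (hx : x ∈ R) (hsa : IsSelfAdjoint x) (hr : ‖x‖ ≤ r) :
    ‖x * b - b * x‖ ≤ r / 2 ^ n * (2 * ‖b‖) := by
  induction n generalizing r x with
  | zero =>
    have h1 := norm_sub_le (x * b) (b * x)
    have h2 := norm_mul_le x b
    have h3 := norm_mul_le b x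
    have h4 := mul_le_mul_of_nonneg_right hr (norm_nonneg b)
    rw [pow_zero, div_one]
    linarith [mul_comm ‖x‖ ‖b‖]
  | succ n ih =>
    obtain ⟨e, he⟩ := exists_proj_norm_sub_le hx hsa hr
    set z := (r / 2) • ((2 : ℝ) • e.op - 1) with hz
    have hzR : z ∈ R := by
      rw [hz, ← Complex.coe_smul, ← Complex.coe_smul]
      exact smul_mem_vonNeumannAlgebra _
        (sub_mem (smul_mem_vonNeumannAlgebra _ e.mem) (one_mem R))
    have hzsa : IsSelfAdjoint z := (IsSelfAdjoint.all _).smul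
      (((IsSelfAdjoint.all _).smul e.isStarProjection.isSelfAdjoint).sub (.one _))
    have hzb : Commute z b :=
      (((hb e).smul_left (2 : ℝ)).sub_left (Commute.one_left b)).smul_left (r / 2)
    have h1 := ih (sub_mem hx hzR) (hsa.sub hzsa) he
    have h2 : (x - z) * b - b * (x - z) = x * b - b * x := by
      rw [sub_mul, mul_sub, hzb.eq]; abel
    rw [h2, div_div, ← pow_succ'] at h1
    exact h1

/-- An operator commuting with all projections of `R` commutes with `R`. -/
theorem commute_of_commute_proj {b : H →L[ℂ] H} (hb : ∀ e : Proj R, Commute e.op b)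
    {x : H →L[ℂ] H} (hx : x ∈ R) : Commute x b := by
  have hsa : ∀ y ∈ R, IsSelfAdjoint y → Commute y b := by
    intro y hy hysa
    have h1 : Filter.Tendsto (fun n : ℕ => ‖y‖ / 2 ^ n * (2 * ‖b‖)) Filter.atTop (nhds 0) := by
      have h2 := (tendsto_pow_atTop_nhds_zero_of_lt_one (r := (1 / 2 : ℝ)) (by norm_num)
        (by norm_num)).const_mul ‖y‖ |>.mul_const (2 * ‖b‖)
      simpa [div_eq_mul_inv] using h2
    have h3 := ge_of_tendsto' h1 fun n => norm_commutator_le_of_commute_proj hb n hy hysa le_rfl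
    exact sub_eq_zero.1 (norm_le_zero_iff.1 h3)
  have hstar : star x ∈ R := star_mem hx
  have h1 := hsa (x + star x) (add_mem hx hstar) (IsSelfAdjoint.add_star_self x)
  have h2 := hsa (Complex.I • (x - star x)) (smul_mem_vonNeumannAlgebra _ (sub_mem hx hstar)) (by
    rw [IsSelfAdjoint, star_smul, star_sub, star_star]
    simp [← smul_neg])
  have h3 : x = (1 / 2 : ℂ) • ((x + star x) + (-Complex.I) • (Complex.I • (x - star x))) := by
    rw [smul_smul, neg_mul, Complex.I_mul_I, neg_neg, one_smul, add_add_sub_cancel, ← two_smul ℂ x,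
      smul_smul]
    norm_num
  rw [h3]
  exact (h1.add_left (h2.smul_left _)).smul_left _

theorem commute_of_forall_proj_commute (h : ∀ p q : Proj R, Commute q.op p.op)
    {a b : H →L[ℂ] H} (ha : a ∈ R) (hb : b ∈ R) : Commute a b :=
  commute_of_commute_proj (fun e => (commute_of_commute_proj (fun f => h e f) hb).symm) ha

/-! ### Spectral families from continuous functions in the abelian case. -/

/-- In an abelian von Neumann algebra meets distribute over suprema, in the form needed for
disjointness. -/
theorem Proj.inf_sSup_eq_bot (hR : ∀ a ∈ R, ∀ b ∈ R, a * b = b * a) {p : Proj R}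
    {S : Set (Proj R)} (h : ∀ q ∈ S, p ⊓ q = ⊥) : p ⊓ sSup S = ⊥ := by
  have h1 : sSup S ≤ p.compl := by
    refine sSup_le fun q hq => (q.le_compl_iff p).2 ?_
    ext x
    -- As `p` and `q` commute, `p (q x)` lies in both ranges.
    refine (Proj.eq_bot_iff _).1 (h q hq) _ ((Proj.mem_range_inf _ _).2 ⟨⟨q.op x, rfl⟩, ?_⟩)
    rw [hR _ p.mem _ q.mem]
    exact ⟨p.op x, rfl⟩
  exact le_bot_iff.1 ((inf_le_inf_left p h1).trans p.inf_compl.le)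

/-- The spectral family of a function on the Stone spectrum. -/
noncomputable def spectralFamilyOfFun (f : StoneSpectrum (Proj R) → ℝ) (l : ℝ) : Proj R :=
  sSup {p | ∀ B ∈ quasipointsAt p, f B ≤ l}

/-- If `l < f B`, continuity gives `p ∈ B` with `f > l` on `quasipointsAt p`. Such a `p` is disjoint
from every projection in the supremum, hence from the supremum itself; only this last step needs
commutativity. -/
theorem le_of_spectralFamilyOfFun_mem (hR : ∀ a ∈ R, ∀ b ∈ R, a * b = b * a)
    {f : StoneSpectrum (Proj R) → ℝ} (hf : Continuous f) {l : ℝ} {B : StoneSpectrum (Proj R)}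
    (hB : spectralFamilyOfFun f l ∈ B.1) : f B ≤ l := by
  by_contra! hlt
  obtain ⟨_, ⟨p, rfl⟩, hpB, hp⟩ := isTopologicalBasis_quasipointsAt.exists_subset_of_mem_open
    (show B ∈ f ⁻¹' Set.Ioi l from hlt) (isOpen_Ioi.preimage hf)
  refine B.inf_ne_bot hpB hB (Proj.inf_sSup_eq_bot hR fun q hq => ?_)
  by_contra hne
  obtain ⟨C, hC⟩ := exists_quasipoint_mem hne
  have h1 : l < f C := hp (C.2.prop.mem_of_le _ hC _ inf_le_left)
  exact absurd (hq C (C.2.prop.mem_of_le _ hC _ inf_le_right)) (not_le.2 h1)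

theorem spectralFamilyOfFun_mem_of_lt {f : StoneSpectrum (Proj R) → ℝ} (hf : Continuous f) {l : ℝ}
    {B : StoneSpectrum (Proj R)} (hB : f B < l) : spectralFamilyOfFun f l ∈ B.1 := by
  obtain ⟨_, ⟨p, rfl⟩, hpB, hp⟩ := isTopologicalBasis_quasipointsAt.exists_subset_of_mem_open
    (show B ∈ f ⁻¹' Set.Iio l from hB) (isOpen_Iio.preimage hf)
  exact B.2.prop.mem_of_le _ hpB _ (le_sSup fun C hC => (show f C < l from hp hC).le)

theorem isBoundedSpectralFamily_spectralFamilyOfFun (hR : ∀ a ∈ R, ∀ b ∈ R, a * b = b * a)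
    {f : StoneSpectrum (Proj R) → ℝ} (hf : Continuous f) {c : ℝ} (hc : ∀ B, |f B| ≤ c) :
    IsBoundedSpectralFamily (spectralFamilyOfFun f) := by
  have hmono : Monotone (spectralFamilyOfFun f) := fun l m hlm =>
    sSup_le_sSup fun p hp B hB => (hp B hB).trans hlm
  refine ⟨hmono, fun l => ?_, ⟨-c - 1, ?_⟩, ⟨c, ?_⟩⟩
  · refine le_antisymm (le_iInf₂ fun m hm => hmono (le_of_lt hm)) (le_sSup fun B hB => ?_)
    -- A quasipoint containing the infimum contains every `E m` with `m > l`, so `f B ≤ m` for all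
    -- these `m`.
    refine le_of_forall_gt_imp_ge_of_dense fun m hm => le_of_spectralFamilyOfFun_mem hR hf ?_
    exact B.2.prop.mem_of_le _ hB _ (iInf₂_le m hm)
  · by_contra hne
    obtain ⟨B, hB⟩ := exists_quasipoint_mem hne
    linarith [le_of_spectralFamilyOfFun_mem hR hf hB, (abs_le.1 (hc B)).1]
  · exact top_le_iff.1 (le_sSup fun B _ => (abs_le.1 (hc B)).2)

theorem obsFun_spectralFamilyOfFun (hR : ∀ a ∈ R, ∀ b ∈ R, a * b = b * a)
    {f : StoneSpectrum (Proj R) → ℝ} (hf : Continuous f) {c : ℝ} (hc : ∀ B, |f B| ≤ c) :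
    obsFun (spectralFamilyOfFun f) = f := by
  have hE := isBoundedSpectralFamily_spectralFamilyOfFun hR hf hc
  funext B
  refine le_antisymm (le_of_forall_gt_imp_ge_of_dense fun l hl => ?_)
    (le_of_forall_gt_imp_ge_of_dense fun l hl => ?_)
  · exact hE.obsFun_le (spectralFamilyOfFun_mem_of_lt hf hl)
  · exact le_of_spectralFamilyOfFun_mem hR hf (hE.mem_of_obsFun_lt hl)

end VonNeumann
end StoneObs

theorem mainTheorem5 {H : Type*} [NormedAddCommGroup H] [InnerProductSpace ℂ H] [CompleteSpace H]
    (R : VonNeumannAlgebra H) :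
    StoneObs.observableFunctions R
        = Set.range (fun (g : BoundedContinuousFunction (StoneObs.StoneSpectrum (StoneObs.Proj R)) ℝ)
            (B : StoneObs.StoneSpectrum (StoneObs.Proj R)) => g B)
      ↔ ∀ a ∈ R, ∀ b ∈ R, a * b = b * a := by
  constructor
  · intro h a ha b hb
    exact StoneObs.commute_of_forall_proj_commute
      (StoneObs.Proj.commute_of_continuous_subset fun g => h ▸ ⟨g, rfl⟩) ha hb
  · intro hR
    refine Set.Subset.antisymm ?_ ?_
    · rintro _ ⟨A, -, -, E, ⟨hE, -⟩, rfl⟩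
      exact hE.exists_boundedContinuousFunction
    · rintro _ ⟨g, rfl⟩
      have hc : ∀ B, |g B| ≤ ‖g‖ := g.norm_coe_le_norm
      obtain ⟨A, hA, hsa, hAE⟩ := (StoneObs.isBoundedSpectralFamily_spectralFamilyOfFun hR
        g.continuous hc).exists_isSpectralFamilyOf
      exact ⟨A, hA, hsa, _, hAE, (StoneObs.obsFun_spectralFamilyOfFun hR g.continuous hc).symm⟩
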